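/- Let $m\ge 0$ and $N\ge 0$ be integers, let $C_n\in\mathbb{C}^{m\times m}$ for $-N\le n\le N$, and let $S(z)=\sum_{n=-N}^{N} C_n z^n$ be positive definite almost everywhere (with respect to arc length) on the unit circle $\mathbb{T}=\{z\in\mathbb{C}:|z|=1\}$. Then $S$ admits a factorization $$S(z)=S^+(z)S^-(z),\qquad z\in\mathbb{C}\setminus\{0\},$$ where $S^+(z)=\sum_{n=0}^{N}A_nz^n$ with $A_n\in\mathbb{C}^{m\times m}$ is a matrix polynomial of degree at most $N$ with $\det S^+(z)\neq 0$ for $|z|<1$, and $S^-(z)=\big(S^+(1/\overline{z})\big)^*=\sum_{n=0}^{N}A_n^*z^{-n}$ is its adjoint (${}^*$ denotes the conjugate transpose of a matrix); accordingly, $S^-$ is analytic and nonsingular in $\{z\in\mathbb{C}:|z|>1\}\cup\{\infty\}$. The factor $S^+$ is unique up to a constant right unitary multiplier: given one such $S^+$, a matrix polynomial $\sum_{n=0}^{N}B_nz^n$ is such a factor if and only if it equals $S^+(z)U$ for some constant unitary matrix $U\in\mathbb{C}^{m\times m}$. -/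

import Mathlib

open scoped ComplexOrder

/-- The `m × m` matrix Laurent polynomial `∑_{n=-N}^{N} C_n z^n`
(meaningful for `z ≠ 0`; only the coefficients `C n` with `-N ≤ n ≤ N` are used). -/
noncomputable def laurentMatrix {m : ℕ} (N : ℕ) (C : ℤ → Matrix (Fin m) (Fin m) ℂ) (z : ℂ) :
    Matrix (Fin m) (Fin m) ℂ :=
  ∑ n ∈ Finset.Icc (-(N : ℤ)) (N : ℤ), z ^ n • C n

/-- A matrix function is positive definite (in particular Hermitian) almost everywhere on the
unit circle, with respect to arc length. -/
def PosDefAEOnCircle {m : ℕ} (S : ℂ → Matrix (Fin m) (Fin m) ℂ) : Prop :=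
  ∀ᵐ θ : ℝ ∂(MeasureTheory.volume.restrict (Set.Ioc (0 : ℝ) (2 * Real.pi))),
    (S (Complex.exp ((θ : ℂ) * Complex.I))).PosDef

/-- The `m × m` matrix polynomial `∑_{n=0}^{N} A_n z^n` of degree at most `N`. -/
noncomputable def polyMatrix {m N : ℕ} (A : Fin (N + 1) → Matrix (Fin m) (Fin m) ℂ) (z : ℂ) :
    Matrix (Fin m) (Fin m) ℂ :=
  ∑ n : Fin (N + 1), z ^ (n : ℕ) • A n

/-- The adjoint of a matrix function with respect to the unit circle: the conjugate transpose
of `F (1 / conj z)`. -/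
noncomputable def circleAdjoint {m : ℕ} (F : ℂ → Matrix (Fin m) (Fin m) ℂ) (z : ℂ) :
    Matrix (Fin m) (Fin m) ℂ :=
  (F (1 / (starRingEnd ℂ) z)).conjTranspose

/-- The matrix polynomial `S⁺` with coefficients `A` is a spectral factor of `S`: it is
nonsingular inside the unit circle, and `S = S⁺ S⁻` on `ℂ \ {0}`, where `S⁻` is the adjoint
of `S⁺`. -/
structure IsSpectralFactor {m N : ℕ} (S : ℂ → Matrix (Fin m) (Fin m) ℂ)
    (A : Fin (N + 1) → Matrix (Fin m) (Fin m) ℂ) : Prop where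
  nonsingular : ∀ z : ℂ, ‖z‖ < 1 → (polyMatrix A z).det ≠ 0
  factorization : ∀ z : ℂ, z ≠ 0 → S z = polyMatrix A z * circleAdjoint (polyMatrix A) z

/-- `F` is analytic (entry by entry) and nonsingular on `{z : |z| > 1} ∪ {∞}`. At `∞` this says
that `F` has a nonsingular limit: an isolated singularity with a finite limit is removable. -/
structure AnalyticNonsingularOutside {m : ℕ} (F : ℂ → Matrix (Fin m) (Fin m) ℂ) : Prop where
  analytic : ∀ i j : Fin m, AnalyticOnNhd ℂ (fun z => F z i j) {z : ℂ | 1 < ‖z‖}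
  nonsingular : ∀ z : ℂ, 1 < ‖z‖ → (F z).det ≠ 0
  at_infinity : ∃ L : Matrix (Fin m) (Fin m) ℂ,
    Filter.Tendsto F (Bornology.cobounded ℂ) (nhds L) ∧ L.det ≠ 0

/-! Existence is a prediction-theoretic argument. Give the `ℂ^m`-valued functions on a period the
semi-inner product with weight `S / 2π`, and let `U` be multiplication by `e^{-iθ}`. The Gram
matrices of the constant unit vectors under powers of `U` are the coefficients of `S`, and vanish
beyond lag `N`. Each constant vector is thus orthogonal to the past older than `N`, and its
expansion in the innovations `U^{-n} e_i` (`exists_wandering_system`) stops at `n = N`. The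
expansion coefficients form a matrix polynomial `P` of degree at most `N` with `S = P Pᴴ` on the
circle (`exists_circle_factorization`).

Zeros of `det P` in the open disc are then removed one at a time by Blaschke-Potapov factors
(`exists_remove_zero`). The identity extends to `z ≠ 0` because both sides become polynomials after
multiplication by `z ^ N`.

For uniqueness, let `P`, `Q` be two factors. `P⁻¹ Q` has no pole in the disc, is bounded on the
circle, and by `P P⁻ = Q Q⁻` (with `P⁻`, `Q⁻` the adjoint factors) has no pole outside. It is
therefore a polynomial matrix (`exists_matrixPolynomial_eq_mul`), and so is its inverse. Being
unitary on the circle, it equals there the conjugate transpose of a polynomial matrix, so it is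
constant. -/

/-! ### Hilbert space of a semi-inner product -/

/-- A linear automorphism preserving a positive semidefinite Hermitian form becomes a unitary
operator on the Hilbert space associated with the form. -/
theorem exists_hilbert_completion_of_core {V : Type} [AddCommGroup V] [Module ℂ V]
    (c : PreInnerProductSpace.Core ℂ V) (T : V ≃ₗ[ℂ] V)
    (hT : ∀ x y, c.inner (T x) (T y) = c.inner x y) :
    ∃ (H : Type) (_ : NormedAddCommGroup H) (_ : InnerProductSpace ℂ H) (_ : CompleteSpace H)
      (ι : V → H) (U : H ≃ₗᵢ[ℂ] H),
      (∀ x y, inner ℂ (ι x) (ι y) = c.inner x y) ∧ ∀ x, U (ι x) = ι (T x) := by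
  let _ : SeminormedAddCommGroup V := InnerProductSpace.Core.toSeminormedAddCommGroup (𝕜 := ℂ)
  let _ : InnerProductSpace ℂ V := InnerProductSpace.ofCore c
  have hinner : ∀ x y : V, inner ℂ x y = c.inner x y := fun _ _ => rfl
  let T' : V ≃ₗᵢ[ℂ] V := ⟨T, fun x => by
    have : ‖T x‖ ^ 2 = ‖x‖ ^ 2 := by
      rw [@norm_sq_eq_re_inner ℂ, @norm_sq_eq_re_inner ℂ, hinner, hinner, hT]
    exact (pow_left_inj₀ (norm_nonneg _) (norm_nonneg _) two_ne_zero).1 this⟩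
  let f : V →L[ℂ] V := T'.toContinuousLinearEquiv
  let g : V →L[ℂ] V := T'.symm.toContinuousLinearEquiv
  have hf : ∀ x : V, f.completion (x : UniformSpace.Completion V) = (T x : V) := fun x =>
    UniformSpace.Completion.map_coe f.uniformContinuous x
  have hg : ∀ x : V, g.completion (x : UniformSpace.Completion V) = (T.symm x : V) := fun x =>
    UniformSpace.Completion.map_coe g.uniformContinuous x
  have hfg : ∀ x, f.completion (g.completion x) = x := fun x =>
    UniformSpace.Completion.induction_on x
      (isClosed_eq (f.completion.continuous.comp g.completion.continuous) continuous_id)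
      fun a => by rw [hg, hf, LinearEquiv.apply_symm_apply]
  have hgf : ∀ x, g.completion (f.completion x) = x := fun x =>
    UniformSpace.Completion.induction_on x
      (isClosed_eq (g.completion.continuous.comp f.completion.continuous) continuous_id)
      fun a => by rw [hf, hg, LinearEquiv.symm_apply_apply]
  have hnorm : ∀ x, ‖f.completion x‖ = ‖x‖ := fun x =>
    UniformSpace.Completion.induction_on x
      (isClosed_eq (continuous_norm.comp f.completion.continuous) continuous_norm)
      fun a => by
        rw [hf, UniformSpace.Completion.norm_coe, UniformSpace.Completion.norm_coe]
        exact T'.norm_map a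
  -- This completion is Hausdorff, so vectors of zero seminorm are identified with zero and no
  -- separate quotient is needed.
  refine ⟨UniformSpace.Completion V, inferInstance, inferInstance, inferInstance,
    fun x => (x : UniformSpace.Completion V),
    ⟨LinearEquiv.ofLinearMap f.completion.toLinearMap g.completion.toLinearMap
      (LinearMap.ext hfg) (LinearMap.ext hgf), hnorm⟩, fun x y => ?_, hf⟩
  rw [UniformSpace.Completion.inner_coe, hinner]

/-! ### Innovations and finite moving averages -/

section Wold

variable {H : Type*} [NormedAddCommGroup H] [InnerProductSpace ℂ H]

local notation "⟪" x ", " y "⟫" => inner ℂ x y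

/-- Linear dependence in `p` is harmless: degenerate Gram-Schmidt vectors normalize to `0` and
contribute nothing. Keeping them fixes the number of vectors at `m`, so that the coefficient
matrices are square. -/
theorem sum_inner_smul_gramSchmidtNormed {m : ℕ} (p : Fin m → H) {x : H}
    (hx : x ∈ Submodule.span ℂ (Set.range p)) :
    ∑ i, ⟪InnerProductSpace.gramSchmidtNormed ℂ p i, x⟫ •
      InnerProductSpace.gramSchmidtNormed ℂ p i = x := by
  set e := InnerProductSpace.gramSchmidtNormed ℂ p with he
  rw [← InnerProductSpace.span_gramSchmidt, ← InnerProductSpace.span_gramSchmidtNormed_range] at hx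
  induction hx using Submodule.span_induction with
  | mem x hx =>
    obtain ⟨j, rfl⟩ := hx
    rw [← he]
    rw [Finset.sum_eq_single j]
    · by_cases h : e j = 0
      · simp [h]
      · rw [inner_self_eq_norm_sq_to_K, InnerProductSpace.gramSchmidtNormed_unit_length' h]
        simp
    · intro i _ hij
      have : ⟪e i, e j⟫ = 0 := by
        simp only [he, InnerProductSpace.gramSchmidtNormed, inner_smul_left, inner_smul_right]
        rw [InnerProductSpace.gramSchmidt_orthogonal ℂ p hij]
        simp
      simp [this]
    · simp
  | zero => simp
  | add x y _ _ hx hy =>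
    simp only [inner_add_right, add_smul, Finset.sum_add_distrib, hx, hy]
  | smul a x _ hx =>
    simp only [inner_smul_right, mul_smul, ← Finset.smul_sum, hx]

/-- The closed linear span of the translates `U ^ j (v a)` with `j ≤ k`. -/
def pastSpan {m : ℕ} (U : H ≃ₗᵢ[ℂ] H) (v : Fin m → H) (k : ℤ) : Submodule ℂ H :=
  (Submodule.span ℂ {x | ∃ j ≤ k, ∃ a, x = (U ^ j) (v a)}).topologicalClosure

variable {m : ℕ} {U : H ≃ₗᵢ[ℂ] H} {v : Fin m → H}

theorem mem_pastSpan {j k : ℤ} (h : j ≤ k) (a : Fin m) : (U ^ j) (v a) ∈ pastSpan U v k :=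
  Submodule.le_topologicalClosure _ (Submodule.subset_span ⟨j, h, a, rfl⟩)

theorem pastSpan_le {k : ℤ} {K : Submodule ℂ H} (hK : IsClosed (K : Set H))
    (h : ∀ j ≤ k, ∀ a, (U ^ j) (v a) ∈ K) : pastSpan U v k ≤ K := by
  refine Submodule.topologicalClosure_minimal _ (Submodule.span_le.2 ?_) hK
  rintro _ ⟨j, hj, a, rfl⟩
  exact h j hj a

theorem pastSpan_induction {k : ℤ} {L : H →L[ℂ] H} {K : Submodule ℂ H} (hK : IsClosed (K : Set H))
    (h : ∀ j ≤ k, ∀ a, L ((U ^ j) (v a)) ∈ K) {x : H} (hx : x ∈ pastSpan U v k) : L x ∈ K :=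
  pastSpan_le (K := K.comap L.toLinearMap) (hK.preimage L.continuous) h hx

theorem isClosed_pastSpan (k : ℤ) : IsClosed (pastSpan U v k : Set H) :=
  Submodule.isClosed_topologicalClosure _

theorem pastSpan_mono {j k : ℤ} (h : j ≤ k) : pastSpan U v j ≤ pastSpan U v k :=
  pastSpan_le (isClosed_pastSpan k) fun _ hi a => mem_pastSpan (hi.trans h) a

theorem zpow_add_apply (j k : ℤ) (x : H) : (U ^ (j + k)) x = (U ^ j) ((U ^ k) x) := by
  rw [zpow_add]; rfl

theorem inner_zpow_left (k : ℤ) (x y : H) : ⟪(U ^ k) x, y⟫ = ⟪x, (U ^ (-k)) y⟫ := by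
  rw [← LinearIsometryEquiv.inner_map_map (U ^ (-k)), ← zpow_add_apply, neg_add_cancel]
  rfl

theorem zpow_mem_pastSpan (j : ℤ) {k : ℤ} {x : H} (hx : x ∈ pastSpan U v k) :
    (U ^ j) x ∈ pastSpan U v (j + k) := by
  refine pastSpan_induction (L := ((U ^ j).toContinuousLinearEquiv : H →L[ℂ] H))
    (isClosed_pastSpan _) (fun i hi a => ?_) hx
  change (U ^ j) ((U ^ i) (v a)) ∈ _
  rw [← zpow_add_apply]
  exact mem_pastSpan (by omega) a

theorem orthogonal_pastSpan {k : ℤ} {x : H} (h : ∀ j ≤ k, ∀ a, ⟪x, (U ^ j) (v a)⟫ = 0) {y : H}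
    (hy : y ∈ pastSpan U v k) : ⟪x, y⟫ = 0 := by
  have : pastSpan U v k ≤ (ℂ ∙ x)ᗮ :=
    pastSpan_le (Submodule.isClosed_orthogonal _) fun j hj a =>
      Submodule.mem_orthogonal_singleton_iff_inner_right.2 (h j hj a)
  exact Submodule.mem_orthogonal_singleton_iff_inner_right.1 (this hy)

/-- The `e i` orthonormalize, up to zero vectors, the innovations `v a - proj (v a)`, where `proj`
projects onto the strict past. Subtracting the `e`-components from `v a` leaves that projection, and
vectors of the strict past are unchanged; continuity handles the closure. -/
theorem exists_wandering_system [CompleteSpace H] (U : H ≃ₗᵢ[ℂ] H) (v : Fin m → H) :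
    ∃ e : Fin m → H, (∀ i, e i ∈ pastSpan U v 0) ∧
      (∀ i, ∀ y ∈ pastSpan U v (-1), ⟪e i, y⟫ = 0) ∧
      ∀ x ∈ pastSpan U v 0, x - ∑ i, ⟪e i, x⟫ • e i ∈ pastSpan U v (-1) := by
  set K := pastSpan U v (-1) with hK
  have _ : CompleteSpace K := (isClosed_pastSpan (-1)).completeSpace_coe
  let p : Fin m → H := fun a => v a - K.starProjection (v a)
  let e := InnerProductSpace.gramSchmidtNormed ℂ p
  have hv : ∀ a, v a ∈ pastSpan U v 0 := fun a => by
    simpa using mem_pastSpan (U := U) (v := v) le_rfl a (k := 0)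
  have hKle : K ≤ pastSpan U v 0 := pastSpan_mono (by norm_num)
  have hpK : ∀ a, p a ∈ Kᗮ := fun a => Submodule.sub_starProjection_mem_orthogonal _
  have hespan : ∀ i, e i ∈ Submodule.span ℂ (Set.range p) := fun i => by
    rw [← InnerProductSpace.span_gramSchmidt, ← InnerProductSpace.span_gramSchmidtNormed_range]
    exact Submodule.subset_span ⟨i, rfl⟩
  have he0 : ∀ i, e i ∈ pastSpan U v 0 := fun i => by
    refine (Submodule.span_le (p := pastSpan U v 0)).2 ?_ (hespan i)
    rintro _ ⟨a, rfl⟩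
    exact Submodule.sub_mem _ (hv a) (hKle (Submodule.starProjection_apply_mem _ _))
  have heK : ∀ i, ∀ y ∈ K, ⟪e i, y⟫ = 0 := fun i y hy => by
    have : e i ∈ Kᗮ := by
      refine (Submodule.span_le (p := Kᗮ)).2 ?_ (hespan i)
      rintro _ ⟨a, rfl⟩
      exact hpK a
    exact Submodule.inner_left_of_mem_orthogonal hy this
  refine ⟨e, he0, heK, fun x hx => ?_⟩
  let L : H →L[ℂ] H := ContinuousLinearMap.id ℂ H - ∑ i, (innerSL ℂ (e i)).smulRight (e i)
  have hL : ∀ x, L x = x - ∑ i, ⟪e i, x⟫ • e i := fun x => by simp [L]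
  rw [← hL]
  refine pastSpan_induction (isClosed_pastSpan _) (fun j hj a => ?_) hx
  rw [hL]
  rcases hj.eq_or_lt with rfl | hj
  · have h1 : ∀ i, ⟪e i, v a⟫ = ⟪e i, p a⟫ := fun i => by
      simp only [p, inner_sub_right, heK i _ (Submodule.starProjection_apply_mem K _), sub_zero]
    have h2 : ∑ i, ⟪e i, p a⟫ • e i = p a :=
      sum_inner_smul_gramSchmidtNormed p (Submodule.subset_span ⟨a, rfl⟩)
    have h3 : (U ^ (0 : ℤ)) (v a) = v a := by simp
    simp only [h3, h1, h2]
    simp only [p, sub_sub_cancel]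
    exact Submodule.starProjection_apply_mem K _
  · have h1 : (U ^ j) (v a) ∈ K := mem_pastSpan (by omega) a
    simpa [heK _ _ h1] using h1

/-- If the translates of the vectors `v a` are orthogonal as soon as the shift exceeds `N`, then
their Gram matrices factor as those of a moving average process of order `N`. -/
theorem exists_movingAverage_factorization [CompleteSpace H] (U : H ≃ₗᵢ[ℂ] H) (v : Fin m → H)
    (N : ℕ) (hN : ∀ k : ℤ, (N : ℤ) < k → ∀ a b, ⟪v b, (U ^ (-k)) (v a)⟫ = 0) :
    ∃ α : ℤ → Matrix (Fin m) (Fin m) ℂ, (∀ k, k < 0 ∨ (N : ℤ) < k → α k = 0) ∧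
      ∀ k : ℤ, ∀ a b, ⟪(U ^ k) (v b), v a⟫ =
        ∑ n ∈ Finset.range (N + 1), (α n * (α (n + k)).conjTranspose) a b := by
  obtain ⟨e, he0, he1, hdec⟩ := exists_wandering_system U v
  have hv : ∀ a, v a ∈ pastSpan U v 0 := fun a => by
    simpa using mem_pastSpan (U := U) (v := v) le_rfl a (k := 0)
  have hmem : ∀ (n : ℤ) i, (U ^ (-n)) (e i) ∈ pastSpan U v (-n) := fun n i => by
    simpa using zpow_mem_pastSpan (-n) (he0 i)
  have horth : ∀ (n : ℤ) i, ∀ y ∈ pastSpan U v (-n - 1), ⟪(U ^ (-n)) (e i), y⟫ = 0 := by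
    intro n i y hy
    rw [inner_zpow_left]
    refine he1 i _ ?_
    have := zpow_mem_pastSpan (- -n) hy
    rwa [show - -n + (-n - 1) = -1 by ring] at this
  have hvorth : ∀ a, ∀ k : ℤ, (N : ℤ) < k → ∀ y ∈ pastSpan U v (-k), ⟪v a, y⟫ = 0 := by
    intro a k hk y hy
    refine orthogonal_pastSpan (fun j hj b => ?_) hy
    have := hN (-j) (by omega) b a
    rwa [neg_neg] at this
  have hstep : ∀ (n : ℤ) (x : H), x ∈ pastSpan U v (-n) →
      x - ∑ i, ⟪(U ^ (-n)) (e i), x⟫ • (U ^ (-n)) (e i) ∈ pastSpan U v (-n - 1) := by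
    intro n x hx
    have h1 : (U ^ n) x ∈ pastSpan U v 0 := by
      simpa using zpow_mem_pastSpan n hx
    have h2 := zpow_mem_pastSpan (-n) (hdec _ h1)
    rw [map_sub, map_sum, ← zpow_add_apply, neg_add_cancel] at h2
    simp only [map_smul] at h2
    have h3 : ∀ i, ⟪e i, (U ^ n) x⟫ = ⟪(U ^ (-n)) (e i), x⟫ := fun i => by
      rw [inner_zpow_left, neg_neg]
    simp only [h3] at h2
    exact h2
  have hres : ∀ a, ∀ r : ℕ, v a - ∑ n ∈ Finset.range r,
      ∑ i, ⟪(U ^ (-(n : ℤ))) (e i), v a⟫ • (U ^ (-(n : ℤ))) (e i) ∈ pastSpan U v (-(r : ℤ)) := by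
    intro a r
    induction r with
    | zero => simpa using hv a
    | succ r ih =>
      have h1 := hstep r _ ih
      -- The terms already subtracted are orthogonal to the older vector `U^{-r} e_i`, so the
      -- coefficient for the remainder is the one for `v a`.
      have h2 : ∀ i, ⟪(U ^ (-(r : ℤ))) (e i), v a - ∑ n ∈ Finset.range r,
          ∑ i, ⟪(U ^ (-(n : ℤ))) (e i), v a⟫ • (U ^ (-(n : ℤ))) (e i)⟫ =
          ⟪(U ^ (-(r : ℤ))) (e i), v a⟫ := by
        intro i
        rw [inner_sub_right, inner_sum, Finset.sum_eq_zero, sub_zero]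
        intro n hn
        rw [inner_sum]
        refine Finset.sum_eq_zero fun l _ => ?_
        have hnr := Finset.mem_range.1 hn
        rw [inner_smul_right]
        refine mul_eq_zero_of_right _ ?_
        rw [← inner_conj_symm, horth n l _ (pastSpan_mono (by omega) (hmem r i)), map_zero]
      simp only [h2] at h1
      rw [Finset.sum_range_succ, ← sub_sub]
      convert h1 using 2
      push_cast; ring
  -- The remainder after `N + 1` terms lies in the past up to `-(N + 1)`. That past is orthogonal to
  -- `v a` and to every subtracted term, so the remainder is orthogonal to itself.
  have hexp : ∀ a, v a = ∑ n ∈ Finset.range (N + 1),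
      ∑ i, ⟪(U ^ (-(n : ℤ))) (e i), v a⟫ • (U ^ (-(n : ℤ))) (e i) := by
    intro a
    have h1 := hres a (N + 1)
    rw [← sub_eq_zero, ← inner_self_eq_zero (𝕜 := ℂ)]
    nth_rewrite 1 [inner_sub_left]
    rw [hvorth a _ (by push_cast; omega) _ h1, sum_inner, Finset.sum_eq_zero, sub_zero]
    intro n hn
    rw [sum_inner]
    refine Finset.sum_eq_zero fun i _ => ?_
    rw [inner_smul_left, horth n i _ (pastSpan_mono ?_ h1), mul_zero]
    have := Finset.mem_range.1 hn
    push_cast; omega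
  refine ⟨fun n => Matrix.of fun a i => ⟪(U ^ (-n)) (e i), v a⟫, fun k hk => ?_, fun k a b => ?_⟩
  · ext a i
    change ⟪(U ^ (-k)) (e i), v a⟫ = 0
    rcases hk with hk | hk
    · exact horth k i _ (pastSpan_mono (by omega) (hv a))
    · rw [← inner_conj_symm, hvorth a k hk _ (hmem k i), map_zero]
  · conv_lhs => rw [hexp a]
    rw [inner_sum]
    refine Finset.sum_congr rfl fun n _ => ?_
    rw [inner_sum, Matrix.mul_apply]
    refine Finset.sum_congr rfl fun i _ => ?_
    rw [inner_smul_right, Matrix.conjTranspose_apply, inner_zpow_left k, ← zpow_add_apply]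
    change _ = _ * star ⟪(U ^ (-((n : ℤ) + k))) (e i), v b⟫
    rw [neg_add_rev, RCLike.star_def, inner_conj_symm]
    rfl

end Wold

/-! ### The weighted space of `S` and its Fourier coefficients -/

open MeasureTheory in
/-- The semi-inner product `⟨f, g⟩ = ∫ gᵀ M f̄` over a period, for a continuous weight `M` that is
almost everywhere positive semidefinite. -/
noncomputable abbrev weightedInnerCore {m : ℕ} (M : ℝ → Matrix (Fin m) (Fin m) ℂ) (hM : Continuous M)
    (hpos : ∀ᵐ θ : ℝ ∂(volume.restrict (Set.Ioc (0 : ℝ) (2 * Real.pi))), (M θ).PosSemidef) :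
    PreInnerProductSpace.Core ℂ C(ℝ, Fin m → ℂ) where
  inner f g := ∫ θ in Set.Ioc (0 : ℝ) (2 * Real.pi), g θ ⬝ᵥ (M θ).mulVec (star (f θ))
  conj_inner_symm f g := by
    rw [← integral_conj]
    refine integral_congr_ae (hpos.mono fun θ hθ => ?_)
    change star (f θ ⬝ᵥ (M θ).mulVec (star (g θ))) = _
    rw [← Matrix.star_dotProduct_star, Matrix.star_mulVec, star_star, hθ.1.eq,
      ← Matrix.dotProduct_mulVec]
  re_inner_nonneg f := by
    have h : (∫ θ in Set.Ioc (0 : ℝ) (2 * Real.pi), f θ ⬝ᵥ (M θ).mulVec (star (f θ))) =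
        ∫ θ in Set.Ioc (0 : ℝ) (2 * Real.pi),
          (((f θ ⬝ᵥ (M θ).mulVec (star (f θ))).re : ℝ) : ℂ) := by
      refine integral_congr_ae (hpos.mono fun θ hθ => ?_)
      have := hθ.dotProduct_mulVec_nonneg (star (f θ))
      rw [star_star] at this
      exact (Complex.eq_re_of_ofReal_le (r := 0) (by simpa using this))
    change 0 ≤ Complex.re _
    rw [h, integral_complex_ofReal, Complex.ofReal_re]
    refine integral_nonneg_of_ae (hpos.mono fun θ hθ => ?_)
    have := hθ.dotProduct_mulVec_nonneg (star (f θ))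
    rw [star_star] at this
    exact (Complex.le_def.1 this).1
  add_left f g h := by
    have hint : ∀ f g : C(ℝ, Fin m → ℂ), Integrable
        (fun θ => g θ ⬝ᵥ (M θ).mulVec (star (f θ)))
        (volume.restrict (Set.Ioc (0 : ℝ) (2 * Real.pi))) := fun f g =>
      (Continuous.integrableOn_Icc (by fun_prop)).mono_set Set.Ioc_subset_Icc_self
    rw [← integral_add (hint f h) (hint g h)]
    refine integral_congr_ae (.of_forall fun θ => ?_)
    simp [Matrix.mulVec_add, dotProduct_add]
  smul_left f g r := by
    rw [← integral_const_mul]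
    refine integral_congr_ae (.of_forall fun θ => ?_)
    simp [Matrix.mulVec_smul]

theorem integral_exp_int_mul_I (k : ℤ) :
    ∫ θ in Set.Ioc (0 : ℝ) (2 * Real.pi), Complex.exp ((k : ℂ) * θ * Complex.I) =
      if k = 0 then ((2 * Real.pi : ℝ) : ℂ) else 0 := by
  rw [← intervalIntegral.integral_of_le Real.two_pi_pos.le]
  split_ifs with h
  · simp [h]
  · have hc : (k : ℂ) * Complex.I ≠ 0 := by simp [h]
    have := integral_exp_mul_complex (a := 0) (b := 2 * Real.pi) hc
    simp only [mul_right_comm (k : ℂ)] at *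
    rw [this]
    have h2 : Complex.exp ((k : ℂ) * ((2 * Real.pi : ℝ) : ℂ) * Complex.I) = 1 := by
      rw [Complex.exp_eq_one_iff]
      exact ⟨k, by push_cast; ring⟩
    rw [mul_right_comm, h2]; simp

theorem exists_movingAverage_of_posDef {m : ℕ} (N : ℕ) (C : ℤ → Matrix (Fin m) (Fin m) ℂ)
    (hS : PosDefAEOnCircle (laurentMatrix N C)) :
    ∃ α : ℤ → Matrix (Fin m) (Fin m) ℂ, (∀ k, k < 0 ∨ (N : ℤ) < k → α k = 0) ∧
      ∀ k ∈ Finset.Icc (-(N : ℤ)) N,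
        C k = ∑ n ∈ Finset.range (N + 1), α n * (α (n - k)).conjTranspose := by
  let M : ℝ → Matrix (Fin m) (Fin m) ℂ := fun θ =>
    ((2 * Real.pi : ℝ) : ℂ)⁻¹ • laurentMatrix N C (Complex.exp ((θ : ℂ) * Complex.I))
  have hMexp : ∀ θ, M θ = ((2 * Real.pi : ℝ) : ℂ)⁻¹ •
      ∑ n ∈ Finset.Icc (-(N : ℤ)) N, Complex.exp ((n : ℂ) * θ * Complex.I) • C n := by
    intro θ
    simp only [M, laurentMatrix, ← Complex.exp_int_mul, mul_assoc]
  have hMcont : Continuous M := by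
    rw [funext hMexp]
    fun_prop
  have hpi : (0 : ℂ) ≤ ((2 * Real.pi : ℝ) : ℂ)⁻¹ := by
    rw [← Complex.ofReal_inv, Complex.zero_le_real]
    positivity
  have hpos : ∀ᵐ θ : ℝ ∂(MeasureTheory.volume.restrict (Set.Ioc (0 : ℝ) (2 * Real.pi))),
      (M θ).PosSemidef := hS.mono fun θ hθ => hθ.posSemidef.smul hpi
  let E : ℤ → C(ℝ, ℂ) := fun k => ⟨fun θ => Complex.exp ((k : ℂ) * θ * Complex.I), by fun_prop⟩
  have hE : ∀ k l θ, E (k + l) θ = E k θ * E l θ := fun k l θ => by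
    simp only [E, ContinuousMap.coe_mk, ← Complex.exp_add]
    push_cast; ring_nf
  have hE0 : ∀ θ, E 0 θ = 1 := fun θ => by simp [E]
  have hEstar : ∀ k θ, star (E k θ) = E (-k) θ := fun k θ => by
    simp only [E, ContinuousMap.coe_mk, RCLike.star_def, ← Complex.exp_conj]
    simp
  -- The sign in `e^{-iθ}` makes `α n` the coefficient of `z ^ n`; with `e^{iθ}` the factor would be
  -- a polynomial in `z⁻¹`.
  let T : C(ℝ, Fin m → ℂ) ≃ₗ[ℂ] C(ℝ, Fin m → ℂ) :=
    { toFun := fun f => E (-1) • f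
      invFun := fun f => E 1 • f
      map_add' := fun f g => by
        ext θ a
        simp [mul_add]
      map_smul' := fun r f => by
        ext θ a
        simp [mul_left_comm]
      left_inv := fun f => by
        ext θ a
        simp [← mul_assoc, ← hE, hE0]
      right_inv := fun f => by
        ext θ a
        simp [← mul_assoc, ← hE, hE0] }
  have hT : ∀ x y, (weightedInnerCore M hMcont hpos).inner (T x) (T y) =
      (weightedInnerCore M hMcont hpos).inner x y := by
    intro x y
    refine MeasureTheory.integral_congr_ae (.of_forall fun θ => ?_)
    change (E (-1) θ • y θ) ⬝ᵥ (M θ).mulVec (star (E (-1) θ • x θ)) = _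
    rw [star_smul, hEstar, Matrix.mulVec_smul, smul_dotProduct, dotProduct_smul, smul_smul, ← hE,
      neg_neg, neg_add_cancel, hE0, one_smul]
  obtain ⟨H, _, _, _, ι, U, hι, hU⟩ :=
    exists_hilbert_completion_of_core (weightedInnerCore M hMcont hpos) T hT
  let u : ℤ → Fin m → C(ℝ, Fin m → ℂ) := fun k a => E (-k) • ContinuousMap.const ℝ (Pi.single a 1)
  have hUpow : ∀ k a, (U ^ k) (ι (u 0 a)) = ι (u k a) := by
    have hUs : ∀ k a, U (ι (u k a)) = ι (u (k + 1) a) := fun k a => by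
      rw [hU]
      congr 1
      ext θ b
      simp [T, u, ← mul_assoc, ← hE, add_comm]
    intro k a
    induction k using Int.induction_on with
    | zero => simp
    | succ k ih => rw [add_comm, zpow_add_apply, ih, zpow_one, hUs, add_comm]
    | pred k ih =>
      apply U.injective
      rw [hUs, sub_add_cancel, ← ih]
      have := zpow_add_apply (U := U) 1 (-(k : ℤ) - 1) (ι (u 0 a))
      rw [zpow_one] at this
      rw [← this]
      congr 2; ring
  have hgram : ∀ k a b, inner ℂ ((U ^ k) (ι (u 0 b))) (ι (u 0 a)) =
      if -k ∈ Finset.Icc (-(N : ℤ)) N then C (-k) a b else 0 := by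
    intro k a b
    rw [hUpow, hι]
    change ∫ θ in Set.Ioc (0 : ℝ) (2 * Real.pi), (E (-0) θ • (Pi.single a 1 : Fin m → ℂ)) ⬝ᵥ
      (M θ).mulVec (star (E (-k) θ • (Pi.single b 1 : Fin m → ℂ))) = _
    have h1 : ∀ θ : ℝ, (E (-0) θ • (Pi.single a 1 : Fin m → ℂ)) ⬝ᵥ
        (M θ).mulVec (star (E (-k) θ • (Pi.single b 1 : Fin m → ℂ))) =
        ((2 * Real.pi : ℝ) : ℂ)⁻¹ * ∑ n ∈ Finset.Icc (-(N : ℤ)) N,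
          Complex.exp (((n + k : ℤ) : ℂ) * θ * Complex.I) * C n a b := by
      intro θ
      rw [star_smul, hEstar, neg_neg, neg_zero, hE0, one_smul, Matrix.mulVec_smul, dotProduct_smul,
        ← Pi.single_star, star_one, Matrix.mulVec_single_one, single_one_dotProduct, hMexp]
      simp only [Matrix.col_apply, Matrix.smul_apply, Matrix.sum_apply, smul_eq_mul]
      rw [mul_left_comm, Finset.mul_sum]
      congr 1
      refine Finset.sum_congr rfl fun n _ => ?_
      rw [← mul_assoc]
      congr 1
      rw [add_comm n k]
      exact (hE k n θ).symm
    simp only [h1]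
    rw [MeasureTheory.integral_const_mul, MeasureTheory.integral_finsetSum]
    · simp only [MeasureTheory.integral_mul_const, integral_exp_int_mul_I, ite_mul, zero_mul,
        add_eq_zero_iff_eq_neg, Finset.sum_ite_eq']
      split_ifs
      · rw [← mul_assoc, inv_mul_cancel₀, one_mul]
        exact_mod_cast Real.two_pi_pos.ne'
      · simp
    · exact fun n _ => (Continuous.integrableOn_Icc (by fun_prop)).mono_set Set.Ioc_subset_Icc_self
  obtain ⟨α, hα, hfac⟩ := exists_movingAverage_factorization U (fun a => ι (u 0 a)) N
    fun k hk a b => by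
      rw [← neg_neg k, ← inner_zpow_left, hgram, if_neg]
      simp only [Finset.mem_Icc]; omega
  refine ⟨α, hα, fun k hk => ?_⟩
  ext a b
  have := hfac (-k) a b
  rw [hgram, neg_neg, if_pos hk] at this
  simpa [Matrix.sum_apply, sub_eq_add_neg] using this

/-- On the circle `(z ^ l • α l)ᴴ = z ^ (-l) • (α l)ᴴ`, so the product is a double sum that regroups
according to `k = n - l`. -/
theorem laurentMatrix_eq_of_movingAverage {m N : ℕ} {C α : ℤ → Matrix (Fin m) (Fin m) ℂ}
    (hα : ∀ k, k < 0 ∨ (N : ℤ) < k → α k = 0)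
    (hC : ∀ k ∈ Finset.Icc (-(N : ℤ)) N,
      C k = ∑ n ∈ Finset.range (N + 1), α n * (α (n - k)).conjTranspose) {z : ℂ} (hz : ‖z‖ = 1) :
    laurentMatrix N C z = polyMatrix (fun n : Fin (N + 1) => α n) z *
      (polyMatrix (fun n : Fin (N + 1) => α n) z).conjTranspose := by
  have hz0 : z ≠ 0 := norm_ne_zero_iff.1 (by rw [hz]; exact one_ne_zero)
  have hstar : star z = z⁻¹ := by rw [Complex.inv_def, Complex.normSq_eq_norm_sq, hz]; simp
  have hpoly : polyMatrix (fun n : Fin (N + 1) => α n) z =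
      ∑ n ∈ Finset.range (N + 1), z ^ n • α n :=
    Fin.sum_univ_eq_sum_range (fun n => z ^ n • α n) (N + 1)
  have hC' : ∀ k ∈ Finset.Icc (-(N : ℤ)) N, z ^ k • C k =
      ∑ n ∈ Finset.range (N + 1), ∑ l ∈ Finset.range (N + 1),
        if (n : ℤ) - l = k then (z ^ n • α n) * (z ^ l • α l).conjTranspose else 0 := by
    intro k hk
    rw [hC k hk, Finset.smul_sum]
    refine Finset.sum_congr rfl fun n _ => ?_
    by_cases h : 0 ≤ n - k ∧ n - k ≤ N
    · rw [Finset.sum_eq_single (n - k).toNat]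
      · rw [if_pos (by omega), Matrix.conjTranspose_smul, Matrix.smul_mul, Matrix.mul_smul,
          smul_smul, star_pow, hstar, Int.toNat_of_nonneg h.1, ← zpow_natCast, ← zpow_natCast,
          Int.toNat_of_nonneg h.1, inv_zpow', ← zpow_add₀ hz0]
        congr 2; ring
      · intro l _ hl
        rw [if_neg (by omega)]
      · intro hl
        rw [Finset.mem_range] at hl
        omega
    · rw [hα (n - k) (by omega), Finset.sum_eq_zero]
      · simp
      · intro l hl
        rw [Finset.mem_range] at hl
        rw [if_neg (by omega)]
  rw [laurentMatrix, Finset.sum_congr rfl hC', hpoly, Matrix.conjTranspose_sum, Finset.sum_mul_sum,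
    Finset.sum_comm]
  refine Finset.sum_congr rfl fun n hn => ?_
  rw [Finset.sum_comm]
  refine Finset.sum_congr rfl fun l hl => ?_
  rw [Finset.mem_range] at hn hl
  rw [Finset.sum_ite_eq, if_pos]
  rw [Finset.mem_Icc]
  omega

theorem exists_circle_factorization {m : ℕ} (N : ℕ) (C : ℤ → Matrix (Fin m) (Fin m) ℂ)
    (hS : PosDefAEOnCircle (laurentMatrix N C)) :
    ∃ A : Fin (N + 1) → Matrix (Fin m) (Fin m) ℂ, ∀ z : ℂ, ‖z‖ = 1 →
      laurentMatrix N C z = polyMatrix A z * (polyMatrix A z).conjTranspose := by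
  obtain ⟨α, hα, hC⟩ := exists_movingAverage_of_posDef N C hS
  exact ⟨_, fun z hz => laurentMatrix_eq_of_movingAverage hα hC hz⟩

/-! ### Scalar polynomials on the unit circle -/

theorem infinite_unitCircle : {z : ℂ | ‖z‖ = 1}.Infinite := by
  have h : (Metric.sphere (0 : ℂ) 1).Infinite := by
    refine (isPreconnected_sphere (by rw [Complex.rank_real_complex]; norm_num) 0 1
      ).infinite_of_nontrivial ⟨1, by simp, -1, by simp, ?_⟩
    norm_num
  refine h.mono fun z hz => ?_
  simpa using hz

/-- The circle has no isolated points. This allows a common factor `X - ζ` with `‖ζ‖ = 1` to be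
cancelled from an inequality on the circle. -/
theorem le_on_unitCircle_of_le_ne {φ ψ : ℂ → ℝ} (hφ : Continuous φ) (hψ : Continuous ψ) {ζ : ℂ}
    (hζ : ‖ζ‖ = 1) (h : ∀ z, ‖z‖ = 1 → z ≠ ζ → φ z ≤ ψ z) : φ ζ ≤ ψ ζ := by
  have hacc : AccPt ζ (Filter.principal (Metric.sphere (0 : ℂ) 1)) :=
    (isPreconnected_sphere (by rw [Complex.rank_real_complex]; norm_num) 0 1
      ).preperfect_of_nontrivial ⟨1, by simp, -1, by simp, by norm_num⟩ ζ (by simpa using hζ)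
  have _ : (nhdsWithin ζ {ζ}ᶜ ⊓ Filter.principal (Metric.sphere (0 : ℂ) 1)).NeBot := hacc
  refine le_of_tendsto_of_tendsto
    (hφ.continuousAt.mono_left (inf_le_left.trans nhdsWithin_le_nhds))
    (hψ.continuousAt.mono_left (inf_le_left.trans nhdsWithin_le_nhds))
    (b := nhdsWithin ζ {ζ}ᶜ ⊓ Filter.principal (Metric.sphere (0 : ℂ) 1)) ?_
  filter_upwards [Filter.mem_inf_of_left self_mem_nhdsWithin,
    Filter.mem_inf_of_right (Filter.mem_principal_self _)] with z hz1 hz2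
  exact h z (by simpa using hz2) hz1

namespace Polynomial

theorem eq_of_eval_eq_unitCircle {p q : ℂ[X]} (h : ∀ z : ℂ, ‖z‖ = 1 → p.eval z = q.eval z) :
    p = q :=
  eq_of_infinite_eval_eq p q (infinite_unitCircle.mono h)

/-- Two polynomials agreeing on the unit circle off the zeros of a nonzero polynomial agree. -/
theorem eq_of_eval_eq_unitCircle_of_ne {p q d : ℂ[X]} (hd : d ≠ 0)
    (h : ∀ z : ℂ, ‖z‖ = 1 → d.eval z ≠ 0 → p.eval z = q.eval z) : p = q := by
  have : d * p = d * q := eq_of_eval_eq_unitCircle fun z hz => by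
    by_cases hdz : d.eval z = 0
    · simp [hdz]
    · rw [eval_mul, eval_mul, h z hz hdz]
  exact mul_left_cancel₀ hd this

theorem exists_unitCircle_eval_ne_zero {d : ℂ[X]} (hd : d ≠ 0) :
    ∃ z : ℂ, ‖z‖ = 1 ∧ d.eval z ≠ 0 := by
  by_contra! h
  exact hd (eq_of_eval_eq_unitCircle fun z hz => by rw [h z hz, eval_zero])

/-- A divisibility criterion: `p` has no zero in the open unit disc, `f` is dominated by `p` on the
unit circle, and `f / p` has no pole outside the closed unit disc. -/
theorem dvd_of_norm_eval_le_of_mul_eq {p f r h : ℂ[X]} (hp : p ≠ 0)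
    (hin : ∀ z : ℂ, ‖z‖ < 1 → p.eval z ≠ 0)
    (hcirc : ∀ z : ℂ, ‖z‖ = 1 → ‖f.eval z‖ ≤ ‖p.eval z‖)
    (hout : ∀ z : ℂ, 1 < ‖z‖ → r.eval z ≠ 0) (hmul : f * r = p * h) : p ∣ f := by
  induction hn : p.natDegree generalizing p f with
  | zero =>
    rw [eq_C_of_natDegree_eq_zero hn] at hp ⊢
    exact (isUnit_C.2 (isUnit_iff_ne_zero.2 fun h0 => hp (by rw [h0, C_0]))).dvd
  | succ n ih =>
    obtain ⟨ζ, hζ⟩ := Complex.exists_root (f := p)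
      (natDegree_pos_iff_degree_pos.1 (by omega))
    have hζ1 : 1 ≤ ‖ζ‖ := not_lt.1 fun hlt => hin ζ hlt hζ
    -- A root of `p` on the circle is a root of `f` by domination; one outside is a root by `f * r =
    -- p * h` with `r ζ ≠ 0`. Cancelling `X - ζ` preserves all hypotheses.
    have hfζ : f.IsRoot ζ := by
      rcases hζ1.eq_or_lt with h1 | h1
      · have := hcirc ζ h1.symm
        rw [hζ.eq_zero, norm_zero] at this
        exact norm_le_zero_iff.1 this
      · have := congrArg (eval ζ) hmul
        rw [eval_mul, eval_mul, hζ.eq_zero, zero_mul] at this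
        exact (mul_eq_zero.1 this).resolve_right (hout ζ h1)
    obtain ⟨p₁, rfl⟩ := dvd_iff_isRoot.2 hζ
    obtain ⟨f₁, rfl⟩ := dvd_iff_isRoot.2 hfζ
    have hX : (X - C ζ) ≠ 0 := X_sub_C_ne_zero ζ
    refine mul_dvd_mul_left _ (ih (right_ne_zero_of_mul hp) (fun z hz => ?_) (fun z hz => ?_) ?_ ?_)
    · have := hin z hz
      rw [eval_mul] at this
      exact right_ne_zero_of_mul this
    · have key : ∀ z : ℂ, ‖z‖ = 1 → z ≠ ζ → ‖f₁.eval z‖ ≤ ‖p₁.eval z‖ := fun z hz hne => by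
        have := hcirc z hz
        simp only [eval_mul, eval_sub, eval_X, eval_C, norm_mul] at this
        exact le_of_mul_le_mul_left this (norm_pos_iff.2 (sub_ne_zero.2 hne))
      by_cases hne : z = ζ
      · subst hne
        exact le_on_unitCircle_of_le_ne (by fun_prop) (by fun_prop) hz key
      · exact key z hz hne
    · refine mul_left_cancel₀ hX ?_
      rw [← mul_assoc, hmul, mul_assoc]
    · rw [natDegree_mul hX (right_ne_zero_of_mul hp), natDegree_X_sub_C] at hn
      omega

/-- A polynomial that agrees on the unit circle, off the zeros of a nonzero polynomial, with the
conjugate of a polynomial is constant. -/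
theorem natDegree_eq_zero_of_conj_eval_eq {f g d : ℂ[X]} (hd : d ≠ 0)
    (h : ∀ z : ℂ, ‖z‖ = 1 → d.eval z ≠ 0 → g.eval z = star (f.eval z)) : g.natDegree = 0 := by
  by_cases hg : g = 0
  · rw [hg, natDegree_zero]
  set f' := f.map (starRingEnd ℂ) with hf'
  -- On the circle `star (f z)` is `f'` at `z⁻¹`, that is, `z ^ (-f'.natDegree)` times the reversal
  -- of `f'`. The reversal has degree at most `f'.natDegree`, leaving degree `0` for `g`.
  have key : g * X ^ f'.natDegree = f'.reverse := eq_of_eval_eq_unitCircle_of_ne hd fun z hz hdz => by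
    have hz0 : z ≠ 0 := norm_ne_zero_iff.1 (by rw [hz]; exact one_ne_zero)
    have hstar : (starRingEnd ℂ) z = z⁻¹ := by
      rw [Complex.inv_def, Complex.normSq_eq_norm_sq, hz]; simp
    let _ : Invertible z⁻¹ := invertibleOfNonzero (inv_ne_zero hz0)
    have h1 := eval₂_reverse_mul_pow (RingHom.id ℂ) z⁻¹ f'
    rw [invOf_eq_inv, inv_inv, ← eval, ← eval] at h1
    have h2 : f'.eval z⁻¹ = star (f.eval z) := by
      rw [hf', ← hstar, eval_map, eval₂_at_apply]; rfl
    rw [eval_mul, h z hz hdz, ← h2, ← h1, eval_pow, eval_X, mul_assoc, ← mul_pow,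
      inv_mul_cancel₀ hz0, one_pow, mul_one]
  have h3 := congrArg natDegree key
  rw [natDegree_mul hg (pow_ne_zero _ X_ne_zero), natDegree_X_pow] at h3
  have := reverse_natDegree_le f'
  omega

end Polynomial

open Polynomial

/-! ### Polynomial matrices: removing zeros in the disc, leaving the circle -/

section PolynomialMatrices

variable {m N : ℕ}

/-- The matrix polynomial with coefficients `A` as a matrix of polynomials. -/
noncomputable def matrixPolynomial (A : Fin (N + 1) → Matrix (Fin m) (Fin m) ℂ) :
    Matrix (Fin m) (Fin m) ℂ[X] :=
  Matrix.of fun i j => ∑ n : Fin (N + 1), C (A n i j) * X ^ (n : ℕ)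

theorem matrixPolynomial_map_eval (A : Fin (N + 1) → Matrix (Fin m) (Fin m) ℂ) (z : ℂ) :
    (matrixPolynomial A).map (eval z) = polyMatrix A z := by
  ext i j
  rw [Matrix.map_apply, matrixPolynomial, Matrix.of_apply, eval_finsetSum, polyMatrix,
    Matrix.sum_apply]
  refine Finset.sum_congr rfl fun n _ => ?_
  rw [eval_mul, eval_C, eval_pow, eval_X, Matrix.smul_apply, smul_eq_mul, mul_comm]

theorem natDegree_matrixPolynomial_le (A : Fin (N + 1) → Matrix (Fin m) (Fin m) ℂ) (i j : Fin m) :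
    (matrixPolynomial A i j).natDegree ≤ N := by
  rw [matrixPolynomial, Matrix.of_apply]
  exact natDegree_sum_le_of_forall_le _ _ fun n _ =>
    (natDegree_C_mul_X_pow_le _ _).trans (Nat.lt_succ_iff.1 n.2)

theorem exists_polyMatrix_eq_map_eval {P : Matrix (Fin m) (Fin m) ℂ[X]}
    (hP : ∀ i j, (P i j).natDegree ≤ N) :
    ∃ A : Fin (N + 1) → Matrix (Fin m) (Fin m) ℂ, ∀ z, polyMatrix A z = P.map (eval z) := by
  refine ⟨fun n => P.map fun p => p.coeff n, fun z => ?_⟩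
  ext i j
  rw [Matrix.map_apply, eval_eq_sum_range' (Nat.lt_succ_iff.2 (hP i j)),
    ← Fin.sum_univ_eq_sum_range (fun n => (P i j).coeff n * z ^ n)]
  simp [polyMatrix, Matrix.sum_apply, mul_comm]

theorem eval_det_eq (P : Matrix (Fin m) (Fin m) ℂ[X]) (z : ℂ) :
    P.det.eval z = (P.map (eval z)).det :=
  RingHom.map_det (evalRingHom z) P

theorem map_eval_mul (P Q : Matrix (Fin m) (Fin m) ℂ[X]) (z : ℂ) :
    (P * Q).map (eval z) = P.map (eval z) * Q.map (eval z) :=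
  Matrix.map_mul (f := evalRingHom z)

theorem map_eval_adjugate (P : Matrix (Fin m) (Fin m) ℂ[X]) (z : ℂ) :
    P.adjugate.map (eval z) = (P.map (eval z)).adjugate :=
  RingHom.map_adjugate (evalRingHom z) P

/-- With `c = b - 1` this matrix is the value of a Blaschke-Potapov factor: it acts as the scalar
`b` on the line of `v` and as the identity on the orthogonal complement. -/
theorem det_one_add_smul_vecMulVec (c : ℂ) {v : Fin m → ℂ} (hv : star v ⬝ᵥ v = 1) :
    (1 + c • Matrix.vecMulVec v (star v)).det = 1 + c := by
  rw [← Matrix.smul_vecMulVec, Matrix.vecMulVec_eq Unit,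
    Matrix.det_one_add_replicateCol_mul_replicateRow, dotProduct_smul, hv, smul_eq_mul, mul_one]

theorem one_add_smul_vecMulVec_mul_conjTranspose {c : ℂ} {v : Fin m → ℂ} (hv : star v ⬝ᵥ v = 1)
    (hc : ‖1 + c‖ = 1) : (1 + c • Matrix.vecMulVec v (star v)) *
      (1 + c • Matrix.vecMulVec v (star v)).conjTranspose = 1 := by
  have hc' : c + star c + c * star c = 0 := by
    have := Complex.mul_conj (1 + c)
    rw [Complex.normSq_eq_norm_sq, hc, map_add, map_one] at this
    have h2 : (1 + c) * (1 + star c) = 1 := by simpa using this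
    linear_combination h2
  rw [Matrix.conjTranspose_add, Matrix.conjTranspose_one, Matrix.conjTranspose_smul,
    Matrix.conjTranspose_vecMulVec, star_star, mul_add, mul_one, add_mul, one_mul,
    Matrix.smul_mul, Matrix.mul_smul, Matrix.vecMulVec_mul_vecMulVec, hv, one_smul, add_assoc,
    smul_smul, ← add_smul, ← add_smul, ← add_assoc, hc', zero_smul, add_zero]

theorem exists_unit_vector_mulVec_eq_zero {M : Matrix (Fin m) (Fin m) ℂ} (h : M.det = 0) :
    ∃ v : Fin m → ℂ, star v ⬝ᵥ v = 1 ∧ M.mulVec v = 0 := by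
  obtain ⟨v, hv, hMv⟩ := Matrix.exists_mulVec_eq_zero_iff.2 h
  set c : ℂ := star v ⬝ᵥ v with hc
  have hpos : 0 < c := Matrix.dotProduct_star_self_pos_iff.2 hv
  have hre : c = (c.re : ℂ) := Complex.eq_re_of_ofReal_le (r := 0) (by simpa using hpos.le)
  have hre_pos : 0 < c.re := (Complex.lt_def.1 hpos).1
  refine ⟨((Real.sqrt c.re : ℝ) : ℂ)⁻¹ • v, ?_, by rw [Matrix.mulVec_smul, hMv, smul_zero]⟩
  rw [star_smul, smul_dotProduct, dotProduct_smul, ← hc, smul_smul, smul_eq_mul, star_inv₀,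
    RCLike.star_def, Complex.conj_ofReal, ← mul_inv, ← Complex.ofReal_mul,
    Real.mul_self_sqrt hre_pos.le, ← hre, inv_mul_cancel₀ hpos.ne']

/-- A zero of the determinant in the open unit disc is removed by a Blaschke-Potapov factor, which
changes neither the degree bound nor the product `P Pᴴ` on the unit circle. -/
theorem exists_remove_zero {P : Matrix (Fin m) (Fin m) ℂ[X]} (hP : ∀ i j, (P i j).natDegree ≤ N)
    {z₀ : ℂ} (hz₀ : ‖z₀‖ < 1) (hroot : P.det.eval z₀ = 0) :
    ∃ P' : Matrix (Fin m) (Fin m) ℂ[X], (∀ i j, (P' i j).natDegree ≤ N) ∧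
      (∀ z : ℂ, ‖z‖ = 1 → P'.map (eval z) * (P'.map (eval z)).conjTranspose =
        P.map (eval z) * (P.map (eval z)).conjTranspose) ∧
      P'.det * (X - C z₀) = P.det * (1 - C (star z₀) * X) := by
  rw [eval_det_eq] at hroot
  obtain ⟨v, hv, hPv⟩ := exists_unit_vector_mulVec_eq_zero hroot
  have hdvd : ∀ i, ∃ w : ℂ[X], ∑ j, P i j * C (v j) = (X - C z₀) * w := fun i => by
    refine dvd_iff_isRoot.2 ?_
    have := congrFun hPv i
    simpa [IsRoot, eval_finsetSum, Matrix.mulVec, dotProduct] using this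
  choose w hw using hdvd
  have hwdeg : ∀ (q : ℂ[X]) (i), q.natDegree ≤ 1 → (q * w i).natDegree ≤ N := fun q i hq => by
    by_cases h0 : w i = 0
    · simp [h0]
    · have h1 : (∑ j, P i j * C (v j)).natDegree ≤ N :=
        natDegree_sum_le_of_forall_le _ _ fun j _ => (natDegree_mul_C_le _ _).trans (hP i j)
      rw [hw, natDegree_mul (X_sub_C_ne_zero _) h0, natDegree_X_sub_C] at h1
      exact natDegree_mul_le.trans (by omega)
  -- `q = (1 - star z₀ X) - (X - z₀)` is the numerator of `b - 1` for `b = (1 - star z₀ X) / (X -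
  -- z₀)`. Since `P v = (X - z₀) w`, the product `P (1 + (b - 1) v vᴴ)` is the polynomial matrix `P
  -- + q w vᴴ`; the degree lost in `w` pays for `q`.
  let q : ℂ[X] := C (1 + z₀) - C (1 + star z₀) * X
  have hq : q.natDegree ≤ 1 := by
    refine (natDegree_sub_le _ _).trans (max_le (by simp) ?_)
    exact (natDegree_C_mul_le _ _).trans natDegree_X_le
  let P' : Matrix (Fin m) (Fin m) ℂ[X] :=
    Matrix.of fun i j => P i j + C (star (v j)) * (q * w i)
  have hfac : ∀ z, z ≠ z₀ → P'.map (eval z) = P.map (eval z) *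
      (1 + ((1 - star z₀ * z) / (z - z₀) - 1) • Matrix.vecMulVec v (star v)) := by
    intro z hz
    have hz' : z - z₀ ≠ 0 := sub_ne_zero.2 hz
    have hPw : (P.map (eval z)).mulVec v = (z - z₀) • fun i => (w i).eval z := by
      ext i
      have := congrArg (eval z) (hw i)
      simpa [eval_finsetSum, Matrix.mulVec, dotProduct] using this
    rw [mul_add, mul_one, Matrix.mul_smul, Matrix.mul_vecMulVec, hPw]
    ext i j
    simp only [P', q, Matrix.map_apply, Matrix.of_apply, Matrix.add_apply, Matrix.smul_apply,
      Matrix.vecMulVec_apply, Pi.smul_apply, smul_eq_mul, eval_add, eval_mul, eval_sub, eval_C,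
      eval_X, Pi.star_apply]
    field_simp
    ring
  refine ⟨P', fun i j => ?_, fun z hz => ?_, ?_⟩
  · exact natDegree_add_le_of_degree_le (hP i j)
      ((natDegree_C_mul_le _ _).trans (hwdeg q i hq))
  · have hne : z ≠ z₀ := fun h => by rw [h] at hz; exact hz₀.ne hz
    rw [hfac z hne, Matrix.conjTranspose_mul, mul_assoc, ← mul_assoc _ _ (Matrix.conjTranspose _),
      one_add_smul_vecMulVec_mul_conjTranspose hv, one_mul]
    have hz0 : z ≠ 0 := norm_ne_zero_iff.1 (by rw [hz]; exact one_ne_zero)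
    have h1 : 1 - star z₀ * z = z * star (z - z₀) := by
      have : z * star z = 1 := by
        rw [RCLike.star_def, Complex.mul_conj, Complex.normSq_eq_norm_sq, hz]; simp
      rw [star_sub, mul_sub, this, mul_comm]
    rw [add_sub_cancel, h1, norm_div, norm_mul, norm_star, hz, one_mul, div_self]
    exact norm_ne_zero_iff.2 (sub_ne_zero.2 hne)
  · refine eq_of_infinite_eval_eq _ _ ((Set.finite_singleton z₀).infinite_compl.mono fun z hz => ?_)
    have hz' : z - z₀ ≠ 0 := sub_ne_zero.2 hz
    change eval z _ = eval z _
    rw [eval_mul, eval_mul, eval_det_eq, hfac z hz, Matrix.det_mul, det_one_add_smul_vecMulVec _ hv,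
      ← eval_det_eq]
    simp only [eval_sub, eval_X, eval_C, eval_one, eval_mul]
    field_simp
    ring

/-- Induction on the number of zeros of `det P` in the open disc, with multiplicity. Each removal
replaces the factor `X - z₀` by `1 - star z₀ X`, which has no zero there. -/
theorem exists_det_ne_zero_in_disc {P : Matrix (Fin m) (Fin m) ℂ[X]}
    (hP : ∀ i j, (P i j).natDegree ≤ N) (hdet : P.det ≠ 0) :
    ∃ P' : Matrix (Fin m) (Fin m) ℂ[X], (∀ i j, (P' i j).natDegree ≤ N) ∧
      (∀ z : ℂ, ‖z‖ = 1 → P'.map (eval z) * (P'.map (eval z)).conjTranspose =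
        P.map (eval z) * (P.map (eval z)).conjTranspose) ∧
      ∀ z : ℂ, ‖z‖ < 1 → P'.det.eval z ≠ 0 := by
  classical
  induction hk : P.det.roots.countP (fun z => ‖z‖ < 1) generalizing P with
  | zero =>
    refine ⟨P, hP, fun _ _ => rfl, fun z hz h0 => ?_⟩
    exact Multiset.countP_eq_zero.1 hk z ((mem_roots hdet).2 h0) hz
  | succ k ih =>
    obtain ⟨z₀, hmem, hz₀⟩ := Multiset.countP_pos.1 (by rw [hk]; exact k.succ_pos)
    obtain ⟨P₁, hdeg, hcirc, hmul⟩ := exists_remove_zero hP hz₀ ((mem_roots hdet).1 hmem)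
    have hlin : (1 - C (star z₀) * X : ℂ[X]) ≠ 0 := fun h => by
      have := congrArg (eval 0) h
      simp at this
    have hne : P.det * (1 - C (star z₀) * X) ≠ 0 := mul_ne_zero hdet hlin
    have hdet₁ : P₁.det ≠ 0 := fun h => hne (by rw [← hmul, h, zero_mul])
    have hroots := congrArg roots hmul
    rw [roots_mul hne, roots_mul (hmul ▸ hne), roots_X_sub_C] at hroots
    have hcount := congrArg (Multiset.countP fun z => ‖z‖ < 1) hroots
    have hlin_count : (1 - C (star z₀) * X : ℂ[X]).roots.countP (fun z => ‖z‖ < 1) = 0 := by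
      refine Multiset.countP_eq_zero.2 fun z hz hlt => ?_
      have h1 : 1 - star z₀ * z = 0 := by simpa using (mem_roots hlin).1 hz
      have h2 : ‖star z₀ * z‖ = 1 := by rw [← sub_eq_zero.1 h1, norm_one]
      rw [norm_mul, norm_star] at h2
      nlinarith [norm_nonneg z, norm_nonneg z₀]
    rw [Multiset.countP_add, Multiset.countP_add, hlin_count, hk, ← Multiset.cons_zero,
      Multiset.countP_cons_of_pos (p := fun z : ℂ => ‖z‖ < 1) _ hz₀, Multiset.countP_zero] at hcount
    obtain ⟨P', h1, h2, h3⟩ := ih hdeg hdet₁ (by omega)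
    exact ⟨P', h1, fun z hz => (h2 z hz).trans (hcirc z hz), h3⟩

/-- The coefficients of the matrix polynomial `z ^ N • F (1 / conj z)ᴴ`, where `F` is the matrix
polynomial with coefficients `A`. -/
noncomputable def reverseAdjoint (A : Fin (N + 1) → Matrix (Fin m) (Fin m) ℂ) :
    Fin (N + 1) → Matrix (Fin m) (Fin m) ℂ :=
  fun n => (A n.rev).conjTranspose

theorem circleAdjoint_polyMatrix (A : Fin (N + 1) → Matrix (Fin m) (Fin m) ℂ) (z : ℂ) :
    circleAdjoint (polyMatrix A) z =
      ∑ n : Fin (N + 1), z ^ (-((n : ℕ) : ℤ)) • (A n).conjTranspose := by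
  simp [circleAdjoint, polyMatrix, Matrix.conjTranspose_sum, Matrix.conjTranspose_smul]

theorem circleAdjoint_of_norm_eq_one (F : ℂ → Matrix (Fin m) (Fin m) ℂ) {z : ℂ} (hz : ‖z‖ = 1) :
    circleAdjoint F z = (F z).conjTranspose := by
  have hz0 : z ≠ 0 := norm_ne_zero_iff.1 (by rw [hz]; exact one_ne_zero)
  have hstar : (starRingEnd ℂ) z = z⁻¹ := by
    rw [Complex.inv_def, Complex.normSq_eq_norm_sq, hz]; simp
  rw [circleAdjoint, hstar, one_div, inv_inv]

theorem polyMatrix_reverseAdjoint (A : Fin (N + 1) → Matrix (Fin m) (Fin m) ℂ) {z : ℂ}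
    (hz : z ≠ 0) :
    polyMatrix (reverseAdjoint A) z = z ^ N • circleAdjoint (polyMatrix A) z := by
  rw [circleAdjoint_polyMatrix, polyMatrix, Finset.smul_sum, ← Equiv.sum_comp Fin.revPerm]
  refine Finset.sum_congr rfl fun n _ => ?_
  rw [reverseAdjoint, Fin.revPerm_apply, Fin.rev_rev, smul_smul, Fin.val_rev, zpow_neg,
    zpow_natCast, ← pow_sub₀ z hz (Nat.lt_succ_iff.1 n.2)]
  congr 2
  omega

/-- Multiplied by `z ^ N`, both sides have polynomial entries, which agree on the infinite set `‖z‖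
= 1`. -/
theorem laurentMatrix_eq_of_unitCircle {C : ℤ → Matrix (Fin m) (Fin m) ℂ}
    {A : Fin (N + 1) → Matrix (Fin m) (Fin m) ℂ}
    (h : ∀ z : ℂ, ‖z‖ = 1 →
      laurentMatrix N C z = polyMatrix A z * (polyMatrix A z).conjTranspose) {z : ℂ} (hz : z ≠ 0) :
    laurentMatrix N C z = polyMatrix A z * circleAdjoint (polyMatrix A) z := by
  ext i j
  let p : ℂ[X] := ∑ k ∈ Finset.Icc (-(N : ℤ)) N, Polynomial.C (C k i j) * X ^ (N + k).toNat
  let q : ℂ[X] := (matrixPolynomial A * matrixPolynomial (reverseAdjoint A)) i j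
  have hp : ∀ z ≠ 0, p.eval z = z ^ N * laurentMatrix N C z i j := by
    intro z hz
    simp only [p, laurentMatrix, Matrix.sum_apply, Matrix.smul_apply, eval_finsetSum, eval_mul,
      eval_C, eval_pow, eval_X, smul_eq_mul, Finset.mul_sum]
    refine Finset.sum_congr rfl fun k hk => ?_
    rw [Finset.mem_Icc] at hk
    rw [mul_comm, ← mul_assoc, ← zpow_natCast, Int.toNat_of_nonneg (by omega), zpow_add₀ hz,
      zpow_natCast]
  have hq : ∀ z ≠ 0, q.eval z =
      z ^ N * (polyMatrix A z * circleAdjoint (polyMatrix A) z) i j := by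
    intro z hz
    change ((matrixPolynomial A * matrixPolynomial (reverseAdjoint A)).map (eval z)) i j = _
    rw [map_eval_mul, matrixPolynomial_map_eval, matrixPolynomial_map_eval,
      polyMatrix_reverseAdjoint A hz, Matrix.mul_smul, Matrix.smul_apply, smul_eq_mul]
  have hpq : p = q := eq_of_eval_eq_unitCircle fun z hz => by
    have hz0 : z ≠ 0 := norm_ne_zero_iff.1 (by rw [hz]; exact one_ne_zero)
    rw [hp z hz0, hq z hz0, h z hz, circleAdjoint_of_norm_eq_one _ hz]
  refine mul_left_cancel₀ (pow_ne_zero N hz) ?_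
  rw [← hp z hz, ← hq z hz, hpq]

theorem exists_isSpectralFactor {C : ℤ → Matrix (Fin m) (Fin m) ℂ}
    (hS : PosDefAEOnCircle (laurentMatrix N C)) :
    ∃ A : Fin (N + 1) → Matrix (Fin m) (Fin m) ℂ, IsSpectralFactor (laurentMatrix N C) A := by
  obtain ⟨A, hA⟩ := exists_circle_factorization N C hS
  -- Positive definiteness at a single point of the circle suffices here.
  have hdet : (matrixPolynomial A).det ≠ 0 := by
    intro h0
    have _ : (MeasureTheory.ae (MeasureTheory.volume.restrict
        (Set.Ioc (0 : ℝ) (2 * Real.pi)))).NeBot := by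
      rw [MeasureTheory.ae_neBot, Ne, MeasureTheory.Measure.restrict_eq_zero, Real.volume_Ioc]
      simp [Real.pi_pos]
    obtain ⟨θ, hθ⟩ := hS.exists
    rw [hA _ (Complex.norm_exp_ofReal_mul_I θ)] at hθ
    have := hθ.det_pos.ne'
    rw [Matrix.det_mul, ← matrixPolynomial_map_eval, ← eval_det_eq, h0] at this
    simp at this
  obtain ⟨P, hP, hcirc, hin⟩ := exists_det_ne_zero_in_disc (natDegree_matrixPolynomial_le A) hdet
  obtain ⟨B, hB⟩ := exists_polyMatrix_eq_map_eval hP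
  refine ⟨B, fun z hz => ?_, fun z hz => laurentMatrix_eq_of_unitCircle (fun z hz => ?_) hz⟩
  · rw [hB, ← eval_det_eq]
    exact hin z hz
  · rw [hB, hcirc z hz, matrixPolynomial_map_eval, hA z hz]

end PolynomialMatrices

/-! ### Uniqueness up to a constant unitary -/

section Uniqueness

variable {m N : ℕ}

theorem det_matrixPolynomial_ne_zero {A : Fin (N + 1) → Matrix (Fin m) (Fin m) ℂ}
    (hA : ∀ z : ℂ, ‖z‖ < 1 → (polyMatrix A z).det ≠ 0) : (matrixPolynomial A).det ≠ 0 := fun h => by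
  refine hA 0 (by simp) ?_
  rw [← matrixPolynomial_map_eval, ← eval_det_eq, h, eval_zero]

theorem det_circleAdjoint_ne_zero {A : Fin (N + 1) → Matrix (Fin m) (Fin m) ℂ}
    (hA : ∀ z : ℂ, ‖z‖ < 1 → (polyMatrix A z).det ≠ 0) {z : ℂ} (hz : 1 < ‖z‖) :
    (circleAdjoint (polyMatrix A) z).det ≠ 0 := by
  rw [circleAdjoint, Matrix.det_conjTranspose]
  refine star_ne_zero.2 (hA _ ?_)
  rw [norm_div, norm_one, RCLike.norm_conj]
  exact (div_lt_one (by linarith)).2 hz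

/-- When `P` is invertible, `P⁻¹ Q` is unitary. The adjugate form of this, that the rows of
`P.adjugate * Q` have norm `‖P.det‖`, also holds at zeros of `det P`. -/
theorem norm_adjugate_mul_apply_le {P Q : Matrix (Fin m) (Fin m) ℂ}
    (h : P * P.conjTranspose = Q * Q.conjTranspose) (i j : Fin m) :
    ‖(P.adjugate * Q) i j‖ ≤ ‖P.det‖ := by
  have h1 : (P.adjugate * Q) * (P.adjugate * Q).conjTranspose = (P.det * star P.det) • 1 := by
    rw [Matrix.conjTranspose_mul, mul_assoc, ← mul_assoc Q, ← h, mul_assoc P,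
      ← Matrix.conjTranspose_mul, Matrix.adjugate_mul, ← mul_assoc, Matrix.adjugate_mul,
      Matrix.conjTranspose_smul, Matrix.conjTranspose_one, Matrix.smul_mul, one_mul, smul_smul]
  have h2 := congrFun (congrFun h1 i) i
  simp only [Matrix.mul_apply, Matrix.conjTranspose_apply, Matrix.smul_apply, Matrix.one_apply_eq,
    smul_eq_mul, mul_one, RCLike.star_def, Complex.mul_conj, ← Complex.ofReal_sum,
    Complex.ofReal_inj, Complex.normSq_eq_norm_sq] at h2
  have h3 : ‖(P.adjugate * Q) i j‖ ^ 2 ≤ ‖P.det‖ ^ 2 := by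
    rw [← h2]
    exact Finset.single_le_sum (f := fun l => ‖∑ k, P.adjugate i k * Q k l‖ ^ 2)
      (fun _ _ => by positivity) (Finset.mem_univ j)
  exact le_of_sq_le_sq h3 (norm_nonneg _)

/-- Two factors of the same function which are both nonsingular in the disc differ by a matrix
polynomial on the right. -/
theorem exists_matrixPolynomial_eq_mul {A B : Fin (N + 1) → Matrix (Fin m) (Fin m) ℂ}
    (hA : ∀ z : ℂ, ‖z‖ < 1 → (polyMatrix A z).det ≠ 0)
    (hB : ∀ z : ℂ, ‖z‖ < 1 → (polyMatrix B z).det ≠ 0)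
    (h : ∀ z : ℂ, ‖z‖ = 1 → polyMatrix A z * (polyMatrix A z).conjTranspose =
      polyMatrix B z * (polyMatrix B z).conjTranspose) :
    ∃ W : Matrix (Fin m) (Fin m) ℂ[X], matrixPolynomial B = matrixPolynomial A * W := by
  set P := matrixPolynomial A with hP
  set Q := matrixPolynomial B with hQ
  set RA := matrixPolynomial (reverseAdjoint A) with hRA
  set RB := matrixPolynomial (reverseAdjoint B) with hRB
  have hPdet : P.det ≠ 0 := det_matrixPolynomial_ne_zero hA
  have hprod : P * RA = Q * RB := by
    ext1 i j
    refine eq_of_eval_eq_unitCircle fun z hz => ?_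
    have hz0 : z ≠ 0 := norm_ne_zero_iff.1 (by rw [hz]; exact one_ne_zero)
    change ((P * RA).map (eval z)) i j = ((Q * RB).map (eval z)) i j
    rw [map_eval_mul, map_eval_mul]
    simp only [hP, hQ, hRA, hRB, matrixPolynomial_map_eval, polyMatrix_reverseAdjoint _ hz0,
      circleAdjoint_of_norm_eq_one _ hz, Matrix.mul_smul, h z hz]
  set F := P.adjugate * Q with hF
  -- This is `P⁻¹ Q = RA RB⁻¹` cleared of denominators. It rules out poles outside the closed disc,
  -- where `det RB` does not vanish.
  have hFR : RB.det • F = P.det • (RA * RB.adjugate) := by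
    have h1 : F * RB = P.det • RA := by
      rw [hF, mul_assoc, ← hprod, ← mul_assoc, Matrix.adjugate_mul, Matrix.smul_mul, one_mul]
    have h2 := congrArg (· * RB.adjugate) h1
    simpa only [mul_assoc, Matrix.mul_adjugate, Matrix.mul_smul, mul_one, Matrix.smul_mul] using h2
  have hdvd : ∀ i j, P.det ∣ F i j := fun i j => by
    refine dvd_of_norm_eval_le_of_mul_eq (r := RB.det) (h := (RA * RB.adjugate) i j) hPdet
      (fun z hz => ?_) (fun z hz => ?_) (fun z hz => ?_) ?_
    · rw [eval_det_eq, hP, matrixPolynomial_map_eval]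
      exact hA z hz
    · change ‖(F.map (eval z)) i j‖ ≤ _
      rw [hF, map_eval_mul, map_eval_adjugate, eval_det_eq]
      refine norm_adjugate_mul_apply_le ?_ i j
      simpa only [hP, hQ, matrixPolynomial_map_eval] using h z hz
    · have hz0 : z ≠ 0 := norm_ne_zero_iff.1 (by linarith)
      rw [eval_det_eq, hRB, matrixPolynomial_map_eval, polyMatrix_reverseAdjoint _ hz0,
        Matrix.det_smul]
      exact mul_ne_zero (pow_ne_zero _ (pow_ne_zero _ hz0)) (det_circleAdjoint_ne_zero hB hz)
    · have := congrFun (congrFun hFR i) j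
      rw [Matrix.smul_apply, Matrix.smul_apply, smul_eq_mul, smul_eq_mul] at this
      rw [mul_comm, this]
  choose W hW using hdvd
  refine ⟨Matrix.of W, ?_⟩
  have hFW : F = P.det • Matrix.of W := by
    ext1 i j
    exact hW i j
  have h1 : P.det • Q = P.det • (P * Matrix.of W) := by
    rw [← Matrix.mul_smul, ← hFW, hF, ← mul_assoc, Matrix.mul_adjugate, Matrix.smul_mul, one_mul]
  exact smul_right_injective _ hPdet h1

/-- The quotients `W = A⁻¹ B` and `V = B⁻¹ A` are both polynomial. On the circle, off the zeros of
`det A`, `W` is unitary with inverse `V`, so `W = Vᴴ` there; this forces each entry of `W` to be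
constant. -/
theorem exists_unitary_of_isSpectralFactor {S : ℂ → Matrix (Fin m) (Fin m) ℂ}
    {A B : Fin (N + 1) → Matrix (Fin m) (Fin m) ℂ} (hA : IsSpectralFactor S A)
    (hB : IsSpectralFactor S B) :
    ∃ U ∈ Matrix.unitaryGroup (Fin m) ℂ, ∀ z : ℂ, polyMatrix B z = polyMatrix A z * U := by
  have h : ∀ z : ℂ, ‖z‖ = 1 → polyMatrix A z * (polyMatrix A z).conjTranspose =
      polyMatrix B z * (polyMatrix B z).conjTranspose := fun z hz => by
    have hz0 : z ≠ 0 := norm_ne_zero_iff.1 (by rw [hz]; exact one_ne_zero)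
    rw [← circleAdjoint_of_norm_eq_one _ hz, ← circleAdjoint_of_norm_eq_one _ hz,
      ← hA.factorization z hz0, ← hB.factorization z hz0]
  obtain ⟨W, hW⟩ := exists_matrixPolynomial_eq_mul hA.nonsingular hB.nonsingular h
  obtain ⟨V, hV⟩ := exists_matrixPolynomial_eq_mul hB.nonsingular hA.nonsingular
    fun z hz => (h z hz).symm
  set P := matrixPolynomial A with hP
  have hPdet : P.det ≠ 0 := det_matrixPolynomial_ne_zero hA.nonsingular
  have hWz : ∀ z, polyMatrix B z = polyMatrix A z * W.map (eval z) := fun z => by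
    rw [← matrixPolynomial_map_eval, hW, map_eval_mul, hP, matrixPolynomial_map_eval]
  have hVz : ∀ z, polyMatrix A z = polyMatrix B z * V.map (eval z) := fun z => by
    rw [← matrixPolynomial_map_eval A, ← hP, hV, map_eval_mul, matrixPolynomial_map_eval]
  have hdetz : ∀ z, P.det.eval z ≠ 0 → IsUnit (polyMatrix A z) := fun z hz => by
    rw [eval_det_eq, hP, matrixPolynomial_map_eval] at hz
    exact (Matrix.isUnit_iff_isUnit_det _).2 (isUnit_iff_ne_zero.2 hz)
  have hunit : ∀ z : ℂ, ‖z‖ = 1 → P.det.eval z ≠ 0 →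
      W.map (eval z) * (W.map (eval z)).conjTranspose = 1 := fun z hz hd => by
    have hu := hdetz z hd
    have h1 := h z hz
    rw [hWz z, Matrix.conjTranspose_mul, mul_assoc] at h1
    have h2 := hu.mul_left_cancel h1
    rw [← mul_assoc] at h2
    have hu' : IsUnit (polyMatrix A z).conjTranspose := hu.star
    exact hu'.mul_right_cancel (h2.symm.trans (one_mul _).symm)
  have hinv : ∀ z : ℂ, P.det.eval z ≠ 0 → W.map (eval z) * V.map (eval z) = 1 := fun z hd => by
    refine (hdetz z hd).mul_left_cancel ?_
    rw [← mul_assoc, ← hWz, ← hVz, mul_one]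
  have hstar : ∀ z : ℂ, ‖z‖ = 1 → P.det.eval z ≠ 0 →
      W.map (eval z) = (V.map (eval z)).conjTranspose := fun z hz hd => by
    have h1 := hunit z hz hd
    have h2 := mul_eq_one_comm.1 (hinv z hd)
    have h3 : V.map (eval z) = (W.map (eval z)).conjTranspose := by
      rw [← mul_one (V.map (eval z)), ← h1, ← mul_assoc, h2, one_mul]
    rw [h3, Matrix.conjTranspose_conjTranspose]
  have hconst : ∀ z, W.map (eval z) = W.map (eval 0) := fun z => by
    ext i j
    have hdeg : (W i j).natDegree = 0 :=
      natDegree_eq_zero_of_conj_eval_eq (f := V j i) hPdet fun z hz hd =>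
        congrFun (congrFun (hstar z hz hd) i) j
    rw [Matrix.map_apply, Matrix.map_apply, eq_C_of_natDegree_eq_zero hdeg, eval_C, eval_C]
  obtain ⟨ζ, hζ, hdζ⟩ := exists_unitCircle_eval_ne_zero hPdet
  refine ⟨W.map (eval 0), Matrix.mem_unitaryGroup_iff.2 ?_, fun z => by rw [hWz, hconst]⟩
  rw [← hconst ζ]
  exact hunit ζ hζ hdζ

end Uniqueness

/-! ### The adjoint factor outside the disc, and the main theorem -/

theorem analyticNonsingularOutside_circleAdjoint {m N : ℕ}
    {A : Fin (N + 1) → Matrix (Fin m) (Fin m) ℂ}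
    (hA : ∀ z : ℂ, ‖z‖ < 1 → (polyMatrix A z).det ≠ 0) :
    AnalyticNonsingularOutside (circleAdjoint (polyMatrix A)) where
  analytic i j := by
    have h : (fun z => circleAdjoint (polyMatrix A) z i j) =
        fun z => ∑ n : Fin (N + 1), z⁻¹ ^ (n : ℕ) * star (A n j i) := by
      ext z
      simp [circleAdjoint_polyMatrix, Matrix.sum_apply]
    rw [h]
    intro z hz
    have hz0 : z ≠ 0 := by
      rintro rfl
      simp at hz
      linarith
    refine Finset.analyticAt_fun_sum _ fun n _ => ?_
    exact ((analyticAt_id.inv hz0).pow _).mul analyticAt_const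
  nonsingular z hz := det_circleAdjoint_ne_zero hA hz
  at_infinity := by
    refine ⟨(polyMatrix A 0).conjTranspose, ?_, ?_⟩
    · have hcont : Continuous (polyMatrix A) := by
        unfold polyMatrix
        fun_prop
      have h1 : Filter.Tendsto (fun z : ℂ => 1 / (starRingEnd ℂ) z) (Bornology.cobounded ℂ)
          (nhds 0) := by
        have h2 : Filter.Tendsto (fun z : ℂ => (starRingEnd ℂ) z⁻¹) (Bornology.cobounded ℂ)
            (nhds ((starRingEnd ℂ) 0)) :=
          (Complex.continuous_conj.tendsto 0).comp Filter.tendsto_inv₀_cobounded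
        simpa using h2
      exact (hcont.matrix_conjTranspose.tendsto 0).comp h1
    · rw [Matrix.det_conjTranspose]
      exact star_ne_zero.2 (hA 0 (by simp))

theorem theorem1 (m N : ℕ) (C : ℤ → Matrix (Fin m) (Fin m) ℂ)
    (hS : PosDefAEOnCircle (laurentMatrix N C)) :
    -- existence of a spectral factor that is a polynomial of degree at most `N`
    (∃ A : Fin (N + 1) → Matrix (Fin m) (Fin m) ℂ, IsSpectralFactor (laurentMatrix N C) A) ∧
    (∀ A : Fin (N + 1) → Matrix (Fin m) (Fin m) ℂ, IsSpectralFactor (laurentMatrix N C) A →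
      -- the adjoint factor is the polynomial in `1 / z` with the adjoint coefficients
      (∀ z : ℂ, z ≠ 0 → circleAdjoint (polyMatrix A) z =
        ∑ n : Fin (N + 1), z ^ (-((n : ℕ) : ℤ)) • (A n).conjTranspose) ∧
      -- it is analytic and nonsingular outside the unit circle
      AnalyticNonsingularOutside (circleAdjoint (polyMatrix A)) ∧
      -- the spectral factors are exactly the constant right unitary multiples of any one of them
      (∀ B : Fin (N + 1) → Matrix (Fin m) (Fin m) ℂ,
        IsSpectralFactor (laurentMatrix N C) B ↔
          ∃ U ∈ Matrix.unitaryGroup (Fin m) ℂ,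
            ∀ z : ℂ, polyMatrix B z = polyMatrix A z * U)) := by
  refine ⟨exists_isSpectralFactor hS, fun A hA => ⟨fun z _ => circleAdjoint_polyMatrix A z,
    analyticNonsingularOutside_circleAdjoint hA.nonsingular, fun B =>
    ⟨exists_unitary_of_isSpectralFactor hA, ?_⟩⟩⟩
  rintro ⟨U, hU, hBU⟩
  refine ⟨fun z hz => ?_, fun z hz => ?_⟩
  · rw [hBU, Matrix.det_mul]
    exact mul_ne_zero (hA.nonsingular z hz)
      ((Matrix.isUnit_iff_isUnit_det _).1 (Unitary.isUnit_coe (U := ⟨U, hU⟩))).ne_zero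
  · have hUU : U * U.conjTranspose = 1 := Matrix.mem_unitaryGroup_iff.1 hU
    rw [hA.factorization z hz, circleAdjoint, circleAdjoint, hBU, hBU, Matrix.conjTranspose_mul,
      mul_assoc, ← mul_assoc U, hUU, one_mul]
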